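/- Let $1\le p\le q<\infty$, $z\in\mathbb{C}$, $L\ge 0$, $a_0,\dots,a_L\in\mathbb{C}$, and put $g(w)=\sum_{\ell=0}^{L}a_\ell w^\ell$. For $n\ge 1$ and $X\in\mathbb{C}^n$ let $$\varphi_\ell(X_1,\dots,X_n)=\ell!\sum_{1\le m_1<\dots<m_\ell\le n}X_{m_1}\cdots X_{m_\ell}$$ (so $\varphi_0=1$, and $\varphi_\ell=0$ if $\ell>n$), and let $d\gamma(x)=\frac{1}{\sqrt{2\pi}}e^{-x^2/2}\,dx$ be the standard Gaussian measure on $\mathbb{R}$. For $0\le k\le n$ let $\mathbb{E}^{x}_{k}$ and $\mathbb{E}^{x}_{n-k}$ denote the uniform averages over $(x_1,\dots,x_k)\in\{-1,1\}^k$ and $(x_{k+1},\dots,x_n)\in\{-1,1\}^{n-k}$, respectively. Let $s\in(0,1)$ and let $k=k(n)$ be non-negative integers with $k(n)/n\to s$ as $n\to\infty$ (so that $k(n)\le n$ for all large $n$). Then, as $n\to\infty$, $$\mathbb{E}^{x}_{k}\left(\mathbb{E}^{x}_{n-k}\left|\sum_{\ell=0}^{L}a_\ell\,\varphi_\ell\left(\frac{x_1}{\sqrt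 n},\dots,\frac{x_k}{\sqrt n},z\frac{x_{k+1}}{\sqrt n},\dots,z\frac{x_n}{\sqrt n}\right)\right|^{q}\right)^{p/q}$$ converges to $$\int_{\mathbb{R}}\left(\int_{\mathbb{R}}\left|\int_{\mathbb{R}}\int_{\mathbb{R}}g\big((u+iv)\sqrt{s}+z(x+iy)\sqrt{1-s}\big)\,d\gamma(v)\,d\gamma(y)\right|^{q}d\gamma(x)\right)^{p/q}d\gamma(u),$$ where all the integrals converge absolutely. -/

import Mathlib

open scoped BigOperators

noncomputable section

namespace CubeGauss

/-- The symmetric function `φ_ℓ(X₁, …, Xₙ) = ℓ! ∑_{m₁ < ⋯ < m_ℓ} X_{m₁} ⋯ X_{m_ℓ}` of `n` complex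
variables (it is `0` when `ℓ > n`, and `1` when `ℓ = 0`). -/
def phi {n : ℕ} (l : ℕ) (X : Fin n → ℂ) : ℂ :=
  (l.factorial : ℂ) * ∑ S ∈ Finset.powersetCard l (Finset.univ : Finset (Fin n)), ∏ j ∈ S, X j

/-- The point `(x₁/√n, …, x_k/√n, z x_{k+1}/√n, …, z xₙ/√n)`, where the signs
`x₁, …, x_k ∈ {-1, 1}` are given by `x'` and `x_{k+1}, …, xₙ ∈ {-1, 1}` by `x''`; the units of `ℤ`
are the signs. Indices in `Fin n` start at `0`, so the first `k` variables are those
with index `j < k`. -/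
def cubePoint (n k : ℕ) (z : ℂ)
    (x' : {j : Fin n // (j : ℕ) < k} → ℤˣ) (x'' : {j : Fin n // ¬ (j : ℕ) < k} → ℤˣ) :
    Fin n → ℂ := fun j =>
  if h : (j : ℕ) < k then (((x' ⟨j, h⟩ : ℤˣ) : ℤ) : ℂ) / (Real.sqrt n : ℂ)
  else z * ((((x'' ⟨j, h⟩ : ℤˣ) : ℤ) : ℂ) / (Real.sqrt n : ℂ))

/-- The mixed-norm expression on the discrete cube: the uniform average over the first `k`
variables of the power `p / q` of the uniform average over the last `n - k` variables of
`|∑_{ℓ ≤ L} a_ℓ φ_ℓ(x₁/√n, …, x_k/√n, z x_{k+1}/√n, …, z xₙ/√n)| ^ q`. -/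
def cubeMixed (p q : ℝ) (z : ℂ) (L : ℕ) (a : ℕ → ℂ) (n k : ℕ) : ℝ :=
  𝔼 x' : {j : Fin n // (j : ℕ) < k} → ℤˣ,
    (𝔼 x'' : {j : Fin n // ¬ (j : ℕ) < k} → ℤˣ,
      ‖∑ l ∈ Finset.range (L + 1), a l * phi l (cubePoint n k z x' x'')‖ ^ q) ^ (p / q)

/-- The standard Gaussian measure on the real line. -/
abbrev gamma : MeasureTheory.Measure ℝ := ProbabilityTheory.gaussianReal 0 1

/-- The polynomial `g(w) = ∑_{ℓ ≤ L} a_ℓ w ^ ℓ`. -/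
def gpoly (L : ℕ) (a : ℕ → ℂ) (w : ℂ) : ℂ := ∑ l ∈ Finset.range (L + 1), a l * w ^ l

/-- The integrand `g((u + i v) √s + z (x + i y) √(1 - s))`. -/
def gaussArg (s : ℝ) (z : ℂ) (L : ℕ) (a : ℕ → ℂ) (u x v y : ℝ) : ℂ :=
  gpoly L a (((u : ℂ) + Complex.I * v) * (Real.sqrt s : ℂ)
    + z * ((x : ℂ) + Complex.I * y) * (Real.sqrt (1 - s) : ℂ))

/-- The two inner Gaussian integrals `∫ ∫ g((u + i v) √s + z (x + i y) √(1 - s)) dγ(v) dγ(y)`. -/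
def gaussInner (s : ℝ) (z : ℂ) (L : ℕ) (a : ℕ → ℂ) (u x : ℝ) : ℂ :=
  ∫ y, ∫ v, gaussArg s z L a u x v y ∂gamma ∂gamma

end CubeGauss

end

/-!
The signs split into two independent blocks, `j < k` and `j ≥ k`, each contributing variables with a
common square (`1 / n`, once the factor `z` is taken out of the second block). For such variables
the generating polynomial `∏ (1 + X_j T)` satisfies a first order linear differential equation
(`derivative_genPoly_mul`), so `i!` times the `i`-th elementary symmetric function is a polynomial
`kraw` in the *sum* of the variables, given by a three-term recursion whose coefficients depend
continuously on the block density `c` and on `ε = 1 / n` (`factorial_mul_genPoly_coeff`).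
Multiplying the two generating polynomials, `∑ a_ℓ φ_ℓ` becomes a fixed jointly continuous function
`mixPoly` of the two densities, `1 / n` and the two block sums (`sum_phi_cubePoint`). At `ε = 0` the
recursion is that of the Hermite polynomials of variance `c`, and Gaussian integration by parts
shows that averaging `((u + i v) √c) ^ i` over `v` gives the same polynomial
(`integral_add_I_mul_mul_sqrt_pow`); hence the inner Gaussian integrals equal `mixPoly` at
`c = s`, `d = 1 - s`, `ε = 0` (`gaussInner_eq_mixPoly`).

The rest is the central limit theorem for the block sums (`tendsto_signProb`, through
characteristic functions and Lévy's theorem), upgraded from bounded continuous integrands to varying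
ones of exponential growth: `tendsto_integral_of_tendsto_prod_nhds`. Its hypothesis, `f_i(x_i) →
g(x)` along all `x_i → x`, is stable under iteration: applied to the last block along the filter
`atTop ×ˢ 𝓝 α`, it shows that the inner averages converge in the same sense as functions of the
first block sum, so that it applies again to the outer average (`mixed_norm_limit`). The bounds
needed are the sub-Gaussian moment bound `cosh x ≤ exp (x ^ 2 / 2)` and the growth bound
`exists_norm_mixPoly_le` with exponential rate `1 / q`; the outer power `p / q ≤ 1` keeps the rate
at most `1`.
-/

noncomputable section

namespace CubeGauss

open MeasureTheory ProbabilityTheory Filter Topology Polynomial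

/-! ### Elementary symmetric functions of signs -/

/-- The Krawtchouk-type polynomials `K_i(A)` with parameters `c` and `ε`, normalised so that
`K_i` is `i!` times the `i`-th elementary symmetric function of `c / ε` variables whose squares
all equal `ε` and whose sum is `A`. At `ε = 0` they are the Hermite polynomials of variance `c`. -/
def kraw (c ε A : ℂ) : ℕ → ℂ
  | 0 => 1
  | 1 => A
  | (i + 2) => A * kraw c ε A (i + 1) - (i + 1) * (c - i * ε) * kraw c ε A i

/-- The generating polynomial `∏ (1 + X_j T)` of the elementary symmetric functions. -/
def genPoly {ι : Type*} (s : Finset ι) (X : ι → ℂ) : ℂ[X] := ∏ j ∈ s, (1 + C (X j) * Polynomial.X)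

lemma genPoly_coeff {ι : Type*} (s : Finset ι) (X : ι → ℂ) (l : ℕ) :
    (genPoly s X).coeff l = ∑ S ∈ s.powersetCard l, ∏ j ∈ S, X j := by
  classical
  have h : ∀ S : Finset ι, ∏ j ∈ S, (C (X j) * Polynomial.X : ℂ[X]) =
      C (∏ j ∈ S, X j) * Polynomial.X ^ S.card := by
    intro S
    rw [Finset.prod_mul_distrib, Finset.prod_const, map_prod]
  rw [genPoly, Finset.prod_one_add, finsetSum_coeff, Finset.powersetCard_eq_filter,
    Finset.sum_filter]
  refine Finset.sum_congr rfl fun S _ => ?_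
  rw [h, coeff_C_mul_X_pow]
  simp only [eq_comm]

lemma phi_eq_coeff {n : ℕ} (l : ℕ) (X : Fin n → ℂ) :
    phi l X = l.factorial * (genPoly Finset.univ X).coeff l := by
  rw [phi, genPoly_coeff]

/-- When all squares `X_j ^ 2` agree, the generating polynomial solves a first order linear
differential equation. -/
lemma derivative_genPoly_mul {ι : Type*} (s : Finset ι) (X : ι → ℂ) (ε : ℂ)
    (hX : ∀ j ∈ s, X j ^ 2 = ε) :
    derivative (genPoly s X) * (1 - C ε * Polynomial.X ^ 2) =
      (C (∑ j ∈ s, X j) - C (s.card * ε) * Polynomial.X) * genPoly s X := by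
  classical
  induction s using Finset.induction_on with
  | empty => simp [genPoly]
  | insert j s hj ih =>
    have ih' := ih fun i hi => hX i (Finset.mem_insert_of_mem hi)
    have hXj : (C ε : ℂ[X]) = C (X j) ^ 2 := by
      rw [← hX j (Finset.mem_insert_self j s), map_pow]
    have hg : genPoly (insert j s) X = (1 + C (X j) * Polynomial.X) * genPoly s X := by
      rw [genPoly, Finset.prod_insert hj, genPoly]
    have hd : derivative (genPoly (insert j s) X) =
        C (X j) * genPoly s X + (1 + C (X j) * Polynomial.X) * derivative (genPoly s X) := by
      rw [hg]; simp
    rw [hd, hg, Finset.sum_insert hj, Finset.card_insert_of_notMem hj]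
    simp only [map_add, map_mul, map_natCast, Nat.cast_add, Nat.cast_one, map_one, map_sum] at ih' ⊢
    linear_combination (1 + C (X j) * Polynomial.X) * ih' +
      (Polynomial.X * genPoly s X) * hXj

lemma factorial_mul_genPoly_coeff {ι : Type*} (s : Finset ι) (X : ι → ℂ) (ε : ℂ)
    (hX : ∀ j ∈ s, X j ^ 2 = ε) (i : ℕ) :
    i.factorial * (genPoly s X).coeff i = kraw (s.card * ε) ε (∑ j ∈ s, X j) i := by
  have key := derivative_genPoly_mul s X ε hX
  have h0 : (genPoly s X).coeff 0 = 1 := by simp [genPoly_coeff]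
  have h1 : (genPoly s X).coeff 1 = ∑ j ∈ s, X j := by
    simp [genPoly_coeff, Finset.powersetCard_one]
  induction i using Nat.twoStepInduction with
  | zero => simp [h0, kraw]
  | one => simp [h1, kraw]
  | more i ih1 ih2 =>
    rw [kraw, ← ih1, ← ih2]
    have hc : (genPoly s X).coeff (i + 2) * (i + 2) - ε * ((genPoly s X).coeff i * i) =
        (∑ j ∈ s, X j) * (genPoly s X).coeff (i + 1) - s.card * ε * (genPoly s X).coeff i := by
      have hk := congrArg (fun P => P.coeff (i + 1)) key
      have e1 : (derivative (genPoly s X) * (1 - C ε * Polynomial.X ^ 2)).coeff (i + 1) =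
          (genPoly s X).coeff (i + 2) * (i + 2) - ε * ((genPoly s X).coeff i * i) := by
        have : derivative (genPoly s X) * (1 - C ε * Polynomial.X ^ 2) =
            derivative (genPoly s X) - C ε * (derivative (genPoly s X) * Polynomial.X * Polynomial.X) := by
          ring
        rw [this, coeff_sub, coeff_C_mul, coeff_mul_X, coeff_derivative]
        congr 1
        · push_cast; ring
        · cases i with
          | zero => simp
          | succ m => rw [coeff_mul_X, coeff_derivative]; push_cast; ring
      have e2 : ((C (∑ j ∈ s, X j) - C (s.card * ε) * Polynomial.X) * genPoly s X).coeff (i + 1) =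
          (∑ j ∈ s, X j) * (genPoly s X).coeff (i + 1) - s.card * ε * (genPoly s X).coeff i := by
        rw [sub_mul, coeff_sub, coeff_C_mul, mul_assoc, coeff_C_mul, coeff_X_mul]
      simpa only [e1, e2] using hk
    rw [Nat.factorial_succ (i + 1), Nat.factorial_succ i]
    push_cast
    linear_combination ((i : ℂ) + 1) * (i.factorial : ℂ) * hc

/-- The two-block polynomial to which `∑ a_ℓ φ_ℓ` reduces: `c` and `d` are the
proportions of variables in the two blocks, `ε` is the common square of the variables (before the
factor `z` is applied), and `α` and `β` are the sums of the variables in the blocks. -/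
def mixPoly (z : ℂ) (L : ℕ) (a : ℕ → ℂ) (c d ε α β : ℝ) : ℂ :=
  ∑ l ∈ Finset.range (L + 1), a l * ∑ ij ∈ Finset.HasAntidiagonal.antidiagonal l,
    (l.choose ij.1 : ℂ) * kraw c ε α ij.1 * (z ^ ij.2 * kraw d ε β ij.2)

lemma coeff_genPoly_const_mul {ι : Type*} (s : Finset ι) (X : ι → ℂ) (z : ℂ) (l : ℕ) :
    (genPoly s fun j => z * X j).coeff l = z ^ l * (genPoly s X).coeff l := by
  rw [genPoly_coeff, genPoly_coeff, Finset.mul_sum]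
  refine Finset.sum_congr rfl fun S hS => ?_
  rw [Finset.prod_mul_distrib, Finset.prod_const, (Finset.mem_powersetCard.1 hS).2]

/-- The scaled sum of a family of signs. -/
def signSum {ι : Type*} [Fintype ι] (r : ℝ) (x : ι → ℤˣ) : ℝ := ∑ j, ((x j : ℤ) : ℝ) * r

/-- This includes `n = 0`, where no variables are present and `1 / n = 0`. -/
lemma phi_cubePoint {n k : ℕ} (l : ℕ) (z : ℂ)
    (x' : {j : Fin n // (j : ℕ) < k} → ℤˣ) (x'' : {j : Fin n // ¬ (j : ℕ) < k} → ℤˣ) :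
    phi l (cubePoint n k z x' x'') = ∑ ij ∈ Finset.HasAntidiagonal.antidiagonal l,
      (l.choose ij.1 : ℂ) *
      kraw ((Fintype.card {j : Fin n // (j : ℕ) < k} / n : ℝ) : ℂ) ((1 / n : ℝ) : ℂ)
        (signSum (1 / √n) x' : ℝ) ij.1 *
      (z ^ ij.2 * kraw ((Fintype.card {j : Fin n // ¬ (j : ℕ) < k} / n : ℝ) : ℂ) ((1 / n : ℝ) : ℂ)
        (signSum (1 / √n) x'' : ℝ) ij.2) := by
  set Y' : {j : Fin n // (j : ℕ) < k} → ℂ := fun j => (((x' j : ℤˣ) : ℤ) : ℂ) / (Real.sqrt n : ℂ)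
  set Y'' : {j : Fin n // ¬ (j : ℕ) < k} → ℂ :=
    fun j => (((x'' j : ℤˣ) : ℤ) : ℂ) / (Real.sqrt n : ℂ)
  have hsq : ∀ t : ℤˣ, (((t : ℤ) : ℂ) / (Real.sqrt n : ℂ)) ^ 2 = 1 / n := by
    intro t
    have h1 : ((t : ℤ) : ℂ) ^ 2 = 1 := by
      rcases Int.units_eq_one_or t with h | h <;> simp [h]
    have h2 : ((√n : ℝ) : ℂ) ^ 2 = n := by
      rw [← Complex.ofReal_pow, Real.sq_sqrt (Nat.cast_nonneg n)]; simp
    rw [div_pow, h1, h2]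
  have hgen : genPoly Finset.univ (cubePoint n k z x' x'') =
      genPoly Finset.univ Y' * genPoly Finset.univ (fun j => z * Y'' j) := by
    rw [genPoly, ← Fintype.prod_subtype_mul_prod_subtype (fun j : Fin n => (j : ℕ) < k)]
    congr 1
    · refine Finset.prod_congr rfl fun j _ => ?_
      simp [cubePoint, j.2, Y']
    · refine Finset.prod_congr rfl fun j _ => ?_
      simp [cubePoint, j.2, Y'']
  have hA : (∑ j, Y' j) = ((signSum (1 / √n) x' : ℝ) : ℂ) := by
    simp [signSum, Y', div_eq_mul_inv]
  have hB : (∑ j, Y'' j) = ((signSum (1 / √n) x'' : ℝ) : ℂ) := by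
    simp [signSum, Y'', div_eq_mul_inv]
  have hK' := factorial_mul_genPoly_coeff Finset.univ Y' (1 / n) fun j _ => hsq _
  have hK'' := factorial_mul_genPoly_coeff Finset.univ Y'' (1 / n) fun j _ => hsq _
  rw [hA] at hK'
  rw [hB] at hK''
  rw [phi_eq_coeff, hgen, coeff_mul, Finset.mul_sum]
  refine Finset.sum_congr rfl fun ij hij => ?_
  rw [coeff_genPoly_const_mul]
  obtain rfl := Finset.HasAntidiagonal.mem_antidiagonal.1 hij
  have hfac : ((ij.1 + ij.2).factorial : ℂ) =
      (ij.1 + ij.2).choose ij.1 * ij.1.factorial * ij.2.factorial := by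
    rw [← Nat.add_choose_mul_factorial_mul_factorial ij.1 ij.2, Nat.choose_symm_add]
    push_cast; rfl
  have hc : ∀ m : ℕ, ((m / n : ℝ) : ℂ) = m * (1 / n) := by intro m; push_cast; ring
  rw [hc, hc]
  push_cast at hK' hK'' ⊢
  simp only [Finset.card_univ] at hK' hK''
  rw [← hK', ← hK'', hfac]
  ring

lemma sum_phi_cubePoint {n k : ℕ} (z : ℂ) (L : ℕ) (a : ℕ → ℂ)
    (x' : {j : Fin n // (j : ℕ) < k} → ℤˣ) (x'' : {j : Fin n // ¬ (j : ℕ) < k} → ℤˣ) :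
    ∑ l ∈ Finset.range (L + 1), a l * phi l (cubePoint n k z x' x'') =
      mixPoly z L a (Fintype.card {j : Fin n // (j : ℕ) < k} / n)
        (Fintype.card {j : Fin n // ¬ (j : ℕ) < k} / n) (1 / n)
        (signSum (1 / √n) x') (signSum (1 / √n) x'') :=
  Finset.sum_congr rfl fun l _ => by rw [phi_cubePoint]

/-! ### Continuity and growth of the two-block polynomial -/

lemma continuous_kraw (i : ℕ) : Continuous fun t : ℂ × ℂ × ℂ => kraw t.1 t.2.1 t.2.2 i := by
  induction i using Nat.twoStepInduction with
  | zero => simp only [kraw]; fun_prop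
  | one => simp only [kraw]; fun_prop
  | more i h1 h2 => simp only [kraw]; fun_prop

lemma continuous_mixPoly (z : ℂ) (L : ℕ) (a : ℕ → ℂ) :
    Continuous fun t : ℝ × ℝ × ℝ × ℝ × ℝ =>
      mixPoly z L a t.1 t.2.1 t.2.2.1 t.2.2.2.1 t.2.2.2.2 := by
  have h1 : ∀ i, Continuous fun t : ℝ × ℝ × ℝ × ℝ × ℝ => kraw t.1 t.2.2.1 t.2.2.2.1 i :=
    fun i => (continuous_kraw i).comp (g := fun t : ℂ × ℂ × ℂ => kraw t.1 t.2.1 t.2.2 i)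
      (f := fun t : ℝ × ℝ × ℝ × ℝ × ℝ => ((t.1 : ℂ), (t.2.2.1 : ℂ), (t.2.2.2.1 : ℂ)))
      (by fun_prop)
  have h2 : ∀ i, Continuous fun t : ℝ × ℝ × ℝ × ℝ × ℝ => kraw t.2.1 t.2.2.1 t.2.2.2.2 i :=
    fun i => (continuous_kraw i).comp (g := fun t : ℂ × ℂ × ℂ => kraw t.1 t.2.1 t.2.2 i)
      (f := fun t : ℝ × ℝ × ℝ × ℝ × ℝ => ((t.2.1 : ℂ), (t.2.2.1 : ℂ), (t.2.2.2.2 : ℂ)))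
      (by fun_prop)
  unfold mixPoly
  fun_prop

/-- Polynomial growth, in the form of an exponential bound of arbitrarily small rate; halving the
rate in the recursion leaves room for the factor `A`. -/
lemma exists_norm_kraw_le (i : ℕ) : ∀ δ : ℝ, 0 < δ → ∃ C : ℝ, 0 ≤ C ∧ ∀ c ε A : ℂ, ‖c‖ ≤ 1 →
    ‖ε‖ ≤ 1 → ‖kraw c ε A i‖ ≤ C * Real.exp (δ * ‖A‖) := by
  have hlin : ∀ δ : ℝ, 0 < δ → ∀ t : ℝ, t ≤ δ⁻¹ * Real.exp (δ * t) := by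
    intro δ hδ t
    have h := Real.add_one_le_exp (δ * t)
    rw [inv_mul_eq_div, le_div_iff₀ hδ]
    linarith
  induction i using Nat.twoStepInduction with
  | zero =>
    refine fun δ hδ => ⟨1, zero_le_one, fun c ε A _ _ => ?_⟩
    simp only [kraw, norm_one, one_mul]
    exact Real.one_le_exp (by positivity)
  | one => exact fun δ hδ => ⟨δ⁻¹, by positivity, fun c ε A _ _ => hlin δ hδ _⟩
  | more i h1 h2 =>
    intro δ hδ
    obtain ⟨C₁, hC₁, H₁⟩ := h1 δ hδ
    obtain ⟨C₂, hC₂, H₂⟩ := h2 (δ / 2) (by positivity)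
    refine ⟨(δ / 2)⁻¹ * C₂ + (i + 1) * (1 + i) * C₁, by positivity, fun c ε A hc hε => ?_⟩
    have e : Real.exp (δ * ‖A‖) = Real.exp (δ / 2 * ‖A‖) * Real.exp (δ / 2 * ‖A‖) := by
      rw [← Real.exp_add]; ring_nf
    have hce : ‖c - i * ε‖ ≤ 1 + i := by
      refine (norm_sub_le _ _).trans ?_
      rw [norm_mul, Complex.norm_natCast]
      exact add_le_add hc (mul_le_of_le_one_right (Nat.cast_nonneg i) hε)
    have hi : ‖((i : ℂ) + 1)‖ = i + 1 := by
      rw [← Nat.cast_one, ← Nat.cast_add, Complex.norm_natCast]; push_cast; rfl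
    calc ‖kraw c ε A (i + 2)‖
        ≤ ‖A‖ * ‖kraw c ε A (i + 1)‖ + (i + 1) * ‖c - i * ε‖ * ‖kraw c ε A i‖ := by
          rw [kraw]
          refine (norm_sub_le _ _).trans ?_
          rw [norm_mul, norm_mul, norm_mul, hi]
      _ ≤ ((δ / 2)⁻¹ * Real.exp (δ / 2 * ‖A‖)) * (C₂ * Real.exp (δ / 2 * ‖A‖)) +
          (i + 1) * (1 + i) * (C₁ * Real.exp (δ * ‖A‖)) := by
          gcongr
          · exact hlin _ (by positivity) _
          · exact H₂ c ε A hc hε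
          · exact H₁ c ε A hc hε
      _ = _ := by rw [e]; ring

lemma exists_norm_mixPoly_le (z : ℂ) (L : ℕ) (a : ℕ → ℂ) {δ : ℝ} (hδ : 0 < δ) :
    ∃ C : ℝ, 0 ≤ C ∧ ∀ c d ε α β : ℝ, |c| ≤ 1 → |d| ≤ 1 → |ε| ≤ 1 →
      ‖mixPoly z L a c d ε α β‖ ≤ C * Real.exp (δ * |α|) * Real.exp (δ * |β|) := by
  choose K hK HK using fun i => exists_norm_kraw_le i δ hδ
  refine ⟨∑ l ∈ Finset.range (L + 1), ‖a l‖ * ∑ ij ∈ Finset.HasAntidiagonal.antidiagonal l,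
    (l.choose ij.1 : ℝ) * K ij.1 * (‖z‖ ^ ij.2 * K ij.2),
    Finset.sum_nonneg fun l _ => mul_nonneg (norm_nonneg _) (Finset.sum_nonneg fun ij _ => ?_),
    fun c d ε α β hc hd hε => ?_⟩
  · have := hK ij.1
    have := hK ij.2
    positivity
  have hk : ∀ (c α : ℝ) (i : ℕ), |c| ≤ 1 → ‖kraw c ε α i‖ ≤ K i * Real.exp (δ * |α|) := by
    intro c α i hc
    have := HK i c ε α (by simpa using hc) (by simpa using hε)
    simpa using this
  rw [mul_assoc, Finset.sum_mul]
  refine norm_sum_le_of_le _ fun l _ => ?_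
  rw [norm_mul, mul_assoc, Finset.sum_mul]
  refine mul_le_mul_of_nonneg_left (norm_sum_le_of_le _ fun ij _ => ?_) (norm_nonneg _)
  rw [norm_mul, norm_mul, norm_mul, norm_pow, Complex.norm_natCast]
  calc _ ≤ (l.choose ij.1 : ℝ) * (K ij.1 * Real.exp (δ * |α|)) *
        (‖z‖ ^ ij.2 * (K ij.2 * Real.exp (δ * |β|))) := by
        have := hK ij.1
        gcongr
        · exact hk c α _ hc
        · exact hk d β _ hd
    _ = _ := by ring

/-! ### Weak convergence and integrands of exponential growth -/

/-- A continuous cutoff, equal to `1` on `[-R, R]` and to `0` outside `[-R - 1, R + 1]`. -/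
def cutoff (R x : ℝ) : ℝ := max 0 (min 1 (R + 1 - |x|))

lemma continuous_cutoff (R : ℝ) : Continuous (cutoff R) := by
  unfold cutoff; fun_prop

lemma cutoff_nonneg (R x : ℝ) : 0 ≤ cutoff R x := le_max_left _ _

lemma cutoff_le_one (R x : ℝ) : cutoff R x ≤ 1 := max_le zero_le_one (min_le_left _ _)

lemma cutoff_eq_one {R x : ℝ} (h : |x| ≤ R) : cutoff R x = 1 := by
  rw [cutoff, min_eq_left (by linarith), max_eq_right zero_le_one]

lemma cutoff_eq_zero {R x : ℝ} (h : R + 1 ≤ |x|) : cutoff R x = 0 := by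
  rw [cutoff, min_eq_right (by linarith), max_eq_left (by linarith)]

lemma integrable_of_abs_le_exp {μ : Measure ℝ} {f : ℝ → ℝ} {C : ℝ}
    (hfm : AEStronglyMeasurable f μ) (hf : ∀ x, |f x| ≤ C * Real.exp |x|)
    (hμ : Integrable (fun x => Real.exp (2 * |x|)) μ) (hC : 0 ≤ C) : Integrable f μ := by
  refine (hμ.const_mul C).mono' hfm (Eventually.of_forall fun x => (hf x).trans ?_)
  gcongr
  linarith [abs_nonneg x]

lemma abs_integral_sub_integral_cutoff_le {μ : Measure ℝ} {f : ℝ → ℝ} {C : ℝ} (hC : 0 ≤ C)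
    (hfm : AEStronglyMeasurable f μ) (hf : ∀ x, |f x| ≤ C * Real.exp |x|)
    (hμ : Integrable (fun x => Real.exp (2 * |x|)) μ) (R : ℝ) :
    |∫ x, f x ∂μ - ∫ x, f x * cutoff R x ∂μ| ≤
      C * Real.exp (-R) * ∫ x, Real.exp (2 * |x|) ∂μ := by
  have hi := integrable_of_abs_le_exp hfm hf hμ hC
  have hi' : Integrable (fun x => f x * cutoff R x) μ := by
    refine hi.mono (hfm.mul (continuous_cutoff R).aestronglyMeasurable)
      (Eventually.of_forall fun x => ?_)
    rw [norm_mul, Real.norm_of_nonneg (cutoff_nonneg R x)]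
    exact mul_le_of_le_one_right (norm_nonneg _) (cutoff_le_one R x)
  rw [← integral_sub hi hi', ← integral_const_mul, ← Real.norm_eq_abs]
  refine norm_integral_le_of_norm_le (hμ.const_mul _) (Eventually.of_forall fun x => ?_)
  rcases le_or_gt |x| R with h | h
  · rw [cutoff_eq_one h, mul_one, sub_self, norm_zero]
    positivity
  · have h1 : ‖f x - f x * cutoff R x‖ ≤ |f x| := by
      rw [← mul_one_sub, norm_mul, Real.norm_eq_abs]
      refine mul_le_of_le_one_right (abs_nonneg _) ?_
      rw [Real.norm_eq_abs, abs_le]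
      constructor <;> linarith [cutoff_nonneg R x, cutoff_le_one R x]
    refine h1.trans ((hf x).trans ?_)
    rw [mul_assoc, ← Real.exp_add]
    gcongr
    linarith

/-- If `f_i(x_i) → g(x)` whenever `x_i → x`, then `g` is continuous, even if the `f_i` are not. -/
lemma continuous_of_tendsto_prod_nhds {ι : Type*} {l : Filter ι} [l.NeBot] {f : ι → ℝ → ℝ}
    {g : ℝ → ℝ}
    (h : ∀ x, Tendsto (fun t : ι × ℝ => f t.1 t.2) (l ×ˢ 𝓝 x) (𝓝 (g x))) : Continuous g := by
  refine continuous_iff_continuousAt.2 fun x => ?_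
  refine (closed_nhds_basis (g x)).tendsto_right_iff.2 fun V hV => ?_
  have h1 : ∀ᶠ t in l ×ˢ 𝓝 x, f t.1 t.2 ∈ V := h x hV.1
  obtain ⟨pa, ha, pb, hb, H⟩ := eventually_prod_iff.1 h1
  filter_upwards [hb] with y hy
  have h2 : Tendsto (fun i => f i y) l (𝓝 (g y)) :=
    (h y).comp (tendsto_id.prodMk tendsto_const_nhds)
  exact hV.2.mem_of_tendsto h2 (ha.mono fun i hi => H hi hy)

/-- If `μ_i → ν` weakly with uniformly bounded exponential moments, and `f_i → g` in the sense
that `f_i(x_i) → g(x)` whenever `x_i → x`, with a uniform exponential bound on the `f_i`, then the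
integrals of `f_i` against `μ_i` converge to that of `g` against `ν`. -/
lemma tendsto_integral_of_tendsto_prod_nhds {ι : Type*} {l : Filter ι} [l.NeBot]
    {μ : ι → ProbabilityMeasure ℝ} {ν : ProbabilityMeasure ℝ} (hμν : Tendsto μ l (𝓝 ν))
    {f : ι → ℝ → ℝ} {g : ℝ → ℝ}
    (hfg : ∀ x, Tendsto (fun t : ι × ℝ => f t.1 t.2) (l ×ˢ 𝓝 x) (𝓝 (g x)))
    (hfm : ∀ i, AEStronglyMeasurable (f i) (μ i : Measure ℝ)) {C M : ℝ} (hC : 0 ≤ C)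
    (hf : ∀ᶠ i in l, ∀ x, |f i x| ≤ C * Real.exp |x|)
    (hμ : ∀ i, Integrable (fun x => Real.exp (2 * |x|)) (μ i : Measure ℝ))
    (hM : ∀ᶠ i in l, ∫ x, Real.exp (2 * |x|) ∂(μ i : Measure ℝ) ≤ M)
    (hν : Integrable (fun x => Real.exp (2 * |x|)) (ν : Measure ℝ)) :
    Continuous g ∧ Integrable g (ν : Measure ℝ) ∧
      Tendsto (fun i => ∫ x, f i x ∂(μ i : Measure ℝ)) l (𝓝 (∫ x, g x ∂(ν : Measure ℝ))) := by
  have hgc : Continuous g := continuous_of_tendsto_prod_nhds hfg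
  have hg : ∀ x, |g x| ≤ C * Real.exp |x| := fun x => by
    have h2 : Tendsto (fun i => f i x) l (𝓝 (g x)) :=
      (hfg x).comp (tendsto_id.prodMk tendsto_const_nhds)
    exact le_of_tendsto h2.abs (hf.mono fun i hi => hi x)
  refine ⟨hgc, integrable_of_abs_le_exp hgc.aestronglyMeasurable hg hν hC, ?_⟩
  set N : ℝ := ∫ x, Real.exp (2 * |x|) ∂(ν : Measure ℝ)
  -- on the support of the cutoff the convergence `f i → g` is uniform
  have hcut : ∀ R, Tendsto (fun i => ∫ x, f i x * cutoff R x ∂(μ i : Measure ℝ)) l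
      (𝓝 (∫ x, g x * cutoff R x ∂(ν : Measure ℝ))) := by
    intro R
    have hw : Tendsto (fun i => ∫ x, g x * cutoff R x ∂(μ i : Measure ℝ)) l
        (𝓝 (∫ x, g x * cutoff R x ∂(ν : Measure ℝ))) := by
      refine ProbabilityMeasure.tendsto_iff_forall_integral_tendsto.1 hμν
        (BoundedContinuousFunction.ofNormedAddCommGroup (fun x => g x * cutoff R x)
          (hgc.mul (continuous_cutoff R)) (C * Real.exp (R + 1)) fun x => ?_)
      rcases le_or_gt (R + 1) |x| with h | h
      · rw [cutoff_eq_zero h, mul_zero, norm_zero]; positivity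
      · rw [norm_mul, Real.norm_of_nonneg (cutoff_nonneg R x), Real.norm_eq_abs]
        refine (mul_le_of_le_one_right (abs_nonneg _) (cutoff_le_one R x)).trans ((hg x).trans ?_)
        gcongr
    have hu : TendstoUniformlyOn f g l (Set.Icc (-(R + 1)) (R + 1)) := by
      refine (tendstoLocallyUniformlyOn_iff_tendstoUniformlyOn_of_compact isCompact_Icc).1
        (TendstoLocallyUniformly.tendstoLocallyUniformlyOn ?_)
      refine tendstoLocallyUniformly_iff_forall_tendsto.2 fun x => ?_
      have h1 : Tendsto (fun y : ι × ℝ => g y.2) (l ×ˢ 𝓝 x) (𝓝 (g x)) :=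
        (hgc.tendsto x).comp tendsto_snd
      exact Filter.Tendsto.mono_right (h1.prodMk_nhds (hfg x)) (nhds_le_uniformity (g x))
    have hd : Tendsto (fun i => ∫ x, f i x * cutoff R x ∂(μ i : Measure ℝ) -
        ∫ x, g x * cutoff R x ∂(μ i : Measure ℝ)) l (𝓝 0) := by
      refine Metric.tendsto_nhds.2 fun e he => ?_
      filter_upwards [Metric.tendstoUniformlyOn_iff.1 hu (e / 2) (by positivity), hf] with i hi hfi
      have hcm := (continuous_cutoff R).aestronglyMeasurable (μ := (μ i : Measure ℝ))
      have hint : ∀ h : ℝ → ℝ, AEStronglyMeasurable h (μ i : Measure ℝ) →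
          (∀ x, |h x| ≤ C * Real.exp |x|) →
          Integrable (fun x => h x * cutoff R x) (μ i : Measure ℝ) := by
        intro h hm hh
        refine integrable_of_abs_le_exp (hm.mul hcm) (fun x => ?_) (hμ i) hC
        rw [abs_mul, abs_of_nonneg (cutoff_nonneg R x)]
        exact (mul_le_of_le_one_right (abs_nonneg _) (cutoff_le_one R x)).trans (hh x)
      rw [dist_zero_right, ← integral_sub (hint _ (hfm i) hfi)
        (hint _ hgc.aestronglyMeasurable hg)]
      refine lt_of_le_of_lt (norm_integral_le_of_norm_le_const (C := e / 2)
        (Eventually.of_forall fun x => ?_)) (by simpa using half_lt_self he)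
      rcases le_or_gt (R + 1) |x| with h | h
      · rw [cutoff_eq_zero h]; simpa using (half_pos he).le
      · rw [← sub_mul, norm_mul, Real.norm_of_nonneg (cutoff_nonneg R x)]
        refine (mul_le_of_le_one_right (norm_nonneg _) (cutoff_le_one R x)).trans ?_
        have := hi x (abs_le.1 h.le)
        rw [dist_comm, Real.dist_eq] at this
        exact this.le
    simpa using hd.add hw
  refine Metric.tendsto_nhds.2 fun e he => ?_
  have htail : Tendsto (fun R : ℝ => C * Real.exp (-R) * (M + N)) atTop (𝓝 0) := by
    simpa using (Real.tendsto_exp_neg_atTop_nhds_zero.const_mul C).mul_const (M + N)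
  obtain ⟨R, hR⟩ := (htail.eventually (gt_mem_nhds (half_pos he))).exists
  filter_upwards [hf, hM, Metric.tendsto_nhds.1 (hcut R) (e / 2) (half_pos he)] with i hfi hMi hci
  have h1 := abs_integral_sub_integral_cutoff_le hC (hfm i) hfi (hμ i) R
  have h2 := abs_integral_sub_integral_cutoff_le hC hgc.aestronglyMeasurable hg hν R
  have h3 : C * Real.exp (-R) * ∫ x, Real.exp (2 * |x|) ∂(μ i : Measure ℝ) ≤
      C * Real.exp (-R) * M := by gcongr
  rw [Real.dist_eq] at hci ⊢
  rw [abs_lt] at hci ⊢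
  rw [abs_le] at h1 h2
  constructor <;> linarith

/-! ### The law of a normalised sum of signs -/

/-- The law of the scaled sum of uniformly random signs. -/
def signLaw (ι : Type*) [Fintype ι] [DecidableEq ι] (r : ℝ) : Measure ℝ :=
  (Fintype.card (ι → ℤˣ) : ENNReal)⁻¹ • ∑ x : ι → ℤˣ, Measure.dirac (signSum r x)

lemma integrable_signLaw (ι : Type*) [Fintype ι] [DecidableEq ι] (r : ℝ) {E : Type*}
    [NormedAddCommGroup E] (f : ℝ → E) : Integrable f (signLaw ι r) := by
  refine Integrable.smul_measure ?_ (by simp)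
  exact integrable_finsetSum_measure.2 fun x _ => integrable_dirac (by simp)

instance (ι : Type*) [Fintype ι] [DecidableEq ι] (r : ℝ) : IsProbabilityMeasure (signLaw ι r) := by
  constructor
  rw [signLaw, Measure.smul_apply, Measure.finsetSum_apply]
  simp only [measure_univ, Finset.sum_const, Finset.card_univ, nsmul_eq_mul, mul_one, smul_eq_mul]
  exact ENNReal.inv_mul_cancel (by simp) (by simp)

lemma integral_signLaw (ι : Type*) [Fintype ι] [DecidableEq ι] (r : ℝ) {E : Type*}
    [NormedAddCommGroup E] [NormedSpace ℝ E] [CompleteSpace E] (f : ℝ → E) :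
    ∫ t, f t ∂(signLaw ι r) =
      (Fintype.card (ι → ℤˣ) : ℝ)⁻¹ • ∑ x : ι → ℤˣ, f (signSum r x) := by
  rw [signLaw, integral_smul_measure,
    integral_finsetSum_measure fun x _ => integrable_dirac (by simp)]
  simp

lemma integral_signLaw_eq_expect (ι : Type*) [Fintype ι] [DecidableEq ι] (r : ℝ) (f : ℝ → ℝ) :
    ∫ t, f t ∂(signLaw ι r) = 𝔼 x : ι → ℤˣ, f (signSum r x) := by
  rw [integral_signLaw, Fintype.expect_eq_sum_div_card, smul_eq_mul, div_eq_inv_mul]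

/-- The signs are independent: exponentials of their sum average to a power of `cosh`. -/
lemma integral_cexp_signLaw (ι : Type*) [Fintype ι] [DecidableEq ι] (r : ℝ) (w : ℂ) :
    ∫ t, Complex.exp (w * t) ∂(signLaw ι r) = Complex.cosh (w * r) ^ Fintype.card ι := by
  have h : ∑ x : ι → ℤˣ, Complex.exp (w * (signSum r x : ℝ)) =
      ∏ _j : ι, ∑ e : ℤˣ, Complex.exp (w * (((e : ℤ) : ℂ) * r)) := by
    rw [Fintype.prod_sum]
    refine Finset.sum_congr rfl fun x _ => ?_
    rw [← Complex.exp_sum, ← Finset.mul_sum]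
    simp [signSum]
  have hsum : ∑ e : ℤˣ, Complex.exp (w * (((e : ℤ) : ℂ) * r)) = 2 * Complex.cosh (w * r) := by
    rw [Complex.two_cosh]
    have : (Finset.univ : Finset ℤˣ) = {1, -1} := rfl
    rw [this, Finset.sum_pair (by decide)]
    simp
  rw [integral_signLaw, h, Finset.prod_const, hsum, mul_pow, Finset.card_univ]
  simp

lemma integral_exp_two_abs_signLaw_le (ι : Type*) [Fintype ι] [DecidableEq ι] (r : ℝ) :
    ∫ t, Real.exp (2 * |t|) ∂(signLaw ι r) ≤ 2 * Real.exp (2 * r ^ 2 * Fintype.card ι) := by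
  have hcosh : ∀ w : ℝ, ∫ t, Real.exp (w * t) ∂(signLaw ι r) =
      Real.cosh (w * r) ^ Fintype.card ι := by
    intro w
    have := integral_cexp_signLaw ι r w
    have h2 : ∫ t, Complex.exp ((w : ℂ) * t) ∂(signLaw ι r) =
        ((∫ t, Real.exp (w * t) ∂(signLaw ι r) : ℝ) : ℂ) := by
      rw [← integral_complex_ofReal]
      refine integral_congr_ae (Eventually.of_forall fun t => ?_)
      push_cast; rfl
    rw [h2] at this
    exact_mod_cast this
  calc ∫ t, Real.exp (2 * |t|) ∂(signLaw ι r)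
      ≤ ∫ t, (Real.exp (2 * t) + Real.exp (-2 * t)) ∂(signLaw ι r) := by
        refine integral_mono (integrable_signLaw _ _ _) (integrable_signLaw _ _ _) fun t => ?_
        have h1 := Real.exp_pos (2 * t)
        have h2 := Real.exp_pos (-2 * t)
        rcases abs_cases t with ⟨h, _⟩ | ⟨h, _⟩
        · simp only [h]; linarith
        · simp only [h]
          rw [show (2 : ℝ) * -t = -2 * t by ring]; linarith
    _ = 2 * Real.cosh (2 * r) ^ Fintype.card ι := by
        rw [integral_add (integrable_signLaw _ _ _) (integrable_signLaw _ _ _), hcosh, hcosh,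
          neg_mul, Real.cosh_neg]
        ring
    _ ≤ 2 * Real.exp ((2 * r) ^ 2 / 2) ^ Fintype.card ι := by
        gcongr
        exact Real.cosh_le_exp_half_sq _
    _ = _ := by rw [← Real.exp_nat_mul]; ring_nf

lemma tendsto_mul_cos_sub_one (t : ℝ) :
    Tendsto (fun n : ℕ => (n : ℝ) * (Real.cos (t * (1 / √n)) - 1)) atTop (𝓝 (-(t ^ 2 / 2))) := by
  have h0 : Tendsto (fun n : ℕ => t * (1 / √(n : ℝ)) / 2) atTop (𝓝 0) := by
    have : Tendsto (fun n : ℕ => 1 / √(n : ℝ)) atTop (𝓝 0) := by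
      simp only [one_div]
      exact tendsto_inv_atTop_zero.comp
        (Real.tendsto_sqrt_atTop.comp tendsto_natCast_atTop_atTop)
    simpa using (this.const_mul t).div_const 2
  have h1 : Tendsto (fun n : ℕ => -(t ^ 2 / 2) * Real.sinc (t * (1 / √(n : ℝ)) / 2) ^ 2) atTop
      (𝓝 (-(t ^ 2 / 2))) := by
    have := (((Real.continuous_sinc.tendsto 0).comp h0).pow 2).const_mul (-(t ^ 2 / 2))
    simpa using this
  refine h1.congr' ?_
  filter_upwards [eventually_gt_atTop 0] with n hn
  have hs : (√(n : ℝ)) ^ 2 = n := Real.sq_sqrt (Nat.cast_nonneg n)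
  have hs0 : √(n : ℝ) ≠ 0 := (Real.sqrt_pos.2 (by exact_mod_cast hn)).ne'
  rcases eq_or_ne t 0 with rfl | ht
  · simp
  -- `cos (2 y) - 1 = -2 sin² y` removes the cancellation
  rw [Real.sinc_of_ne_zero (by positivity)]
  set y := t * (1 / √(n : ℝ)) / 2 with hy
  have hc : Real.cos (t * (1 / √(n : ℝ))) = 1 - 2 * Real.sin y ^ 2 := by
    rw [show t * (1 / √(n : ℝ)) = 2 * y by rw [hy]; ring, Real.cos_two_mul, Real.cos_sq']; ring
  have hy2 : y ^ 2 * (4 * n) = t ^ 2 := by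
    have h : y ^ 2 * (4 * √(n : ℝ) ^ 2) = t ^ 2 := by
      rw [hy]; field_simp; norm_num
    rwa [hs] at h
  have hy0 : y ≠ 0 := by rw [hy]; positivity
  rw [hc, ← hy2]
  field_simp
  ring

/-- `signLaw` as a point of the space of probability measures with its weak topology. -/
def signProb (ι : Type*) [Fintype ι] [DecidableEq ι] (r : ℝ) : ProbabilityMeasure ℝ :=
  ⟨signLaw ι r, inferInstance⟩

/-- The centred Gaussian law of variance `σ` as a point of the space of probability measures. -/
def gaussProb (σ : NNReal) : ProbabilityMeasure ℝ := ⟨gaussianReal 0 σ, inferInstance⟩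

/-- De Moivre–Laplace for `m n` signs scaled by `1 / √n`, when `m n / n → σ`. -/
lemma tendsto_signProb {ι : ℕ → Type} [∀ n, Fintype (ι n)] [∀ n, DecidableEq (ι n)] {σ : NNReal}
    (hσ : Tendsto (fun n => (Fintype.card (ι n) : ℝ) / n) atTop (𝓝 (σ : ℝ))) :
    Tendsto (fun n => signProb (ι n) (1 / √n)) atTop (𝓝 (gaussProb σ)) := by
  refine ProbabilityMeasure.tendsto_iff_tendsto_charFun.2 fun t => ?_
  have hchar : ∀ n, charFun (signLaw (ι n) (1 / √n)) t =
      ((Real.cos (t * (1 / √n)) ^ Fintype.card (ι n) : ℝ) : ℂ) := by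
    intro n
    rw [charFun_apply_real]
    have h := integral_cexp_signLaw (ι n) (1 / √n) (t * Complex.I)
    rw [show (t * Complex.I : ℂ) * ((1 / √n : ℝ) : ℂ) = ((t * (1 / √n) : ℝ) : ℂ) * Complex.I by
      push_cast; ring, Complex.cosh_mul_I] at h
    push_cast at h ⊢
    rw [← h]
    refine integral_congr_ae (Eventually.of_forall fun x => ?_)
    simp only; ring_nf
  have hlim : Tendsto (fun n : ℕ => Real.cos (t * (1 / √n)) ^ Fintype.card (ι n)) atTop
      (𝓝 (Real.exp (-(σ * t ^ 2 / 2)))) := by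
    have h1 := Real.tendsto_one_add_pow_exp_of_tendsto (tendsto_mul_cos_sub_one t)
    simp only [add_sub_cancel] at h1
    -- the exponent `m n = n * (m n / n)` is not tied to `n`: raise the limit of the `n`-th powers
    -- to the real power `m n / n`, which is legitimate once the cosine is positive
    have h2 := h1.rpow hσ (Or.inl (Real.exp_pos _).ne')
    rw [← Real.exp_mul, show -(t ^ 2 / 2) * (σ : ℝ) = -(σ * t ^ 2 / 2) by ring] at h2
    refine h2.congr' ?_
    have hcos : ∀ᶠ n : ℕ in atTop, 0 < Real.cos (t * (1 / √(n : ℝ))) := by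
      have : Tendsto (fun n : ℕ => Real.cos (t * (1 / √(n : ℝ)))) atTop (𝓝 (Real.cos (t * 0))) := by
        refine (Real.continuous_cos.tendsto _).comp (Tendsto.const_mul t ?_)
        simp only [one_div]
        exact tendsto_inv_atTop_zero.comp
          (Real.tendsto_sqrt_atTop.comp tendsto_natCast_atTop_atTop)
      exact this.eventually (lt_mem_nhds (by simp))
    filter_upwards [hcos, eventually_gt_atTop 0] with n hn hn0
    rw [← Real.rpow_natCast, ← Real.rpow_mul hn.le, mul_div_cancel₀ _ (by positivity),
      Real.rpow_natCast]
  have hexp : charFun (gaussianReal 0 σ) t = ((Real.exp (-(σ * t ^ 2 / 2)) : ℝ) : ℂ) := by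
    rw [charFun_gaussianReal]
    push_cast
    ring_nf
  simp only [signProb, gaussProb, ProbabilityMeasure.coe_mk, hchar, hexp]
  exact (Complex.continuous_ofReal.tendsto _).comp hlim

/-! ### Gaussian integrals of complex polynomials -/

lemma integrable_add_I_mul_pow (u : ℂ) (m : ℕ) :
    Integrable (fun v : ℝ => (u + Complex.I * v) ^ m) gamma := by
  rcases Nat.eq_zero_or_pos m with rfl | hm
  · simp
  have h1 : MemLp (fun v : ℝ => u + Complex.I * v) m gamma := by
    have h2 : MemLp (fun v : ℝ => (v : ℂ)) (m : ℕ) gamma := by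
      have := memLp_id_gaussianReal (μ := 0) (v := 1) (m : NNReal)
      exact this.ofReal
    exact (memLp_const u).add (h2.const_mul Complex.I)
  refine (h1.integrable_norm_pow hm.ne').mono' (by fun_prop) (Eventually.of_forall fun v => ?_)
  rw [norm_pow]

/-- Gaussian integration by parts, in the form of the three-term recursion for the Hermite
polynomials `∫ (u + i v) ^ m dγ(v)`. -/
lemma integral_add_I_mul_pow_succ_succ (u : ℂ) (m : ℕ) :
    ∫ v : ℝ, (u + Complex.I * v) ^ (m + 2) ∂gamma =
      u * ∫ v : ℝ, (u + Complex.I * v) ^ (m + 1) ∂gamma -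
        (m + 1) * ∫ v : ℝ, (u + Complex.I * v) ^ m ∂gamma := by
  have hI : ∀ f : ℝ → ℂ, Integrable f gamma ↔
      Integrable (fun x => gaussianPDFReal 0 1 x • f x) := by
    intro f
    rw [gamma, gaussianReal_of_var_ne_zero 0 one_ne_zero,
      integrable_withDensity_iff_integrable_smul' (measurable_gaussianPDF 0 1)
        (Eventually.of_forall fun x => gaussianPDF_lt_top)]
    simp only [toReal_gaussianPDF]
  have hpdf : ∀ x : ℝ, HasDerivAt (gaussianPDFReal 0 1) (-x * gaussianPDFReal 0 1 x) x := by
    intro x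
    have h1 : HasDerivAt (fun y : ℝ => -(y - 0) ^ 2 / (2 * ((1 : NNReal) : ℝ))) (-x) x := by
      refine (((((hasDerivAt_id x).sub_const 0).pow 2).neg).div_const
        (2 * ((1 : NNReal) : ℝ))).congr_deriv ?_
      simp
      ring
    rw [gaussianPDFReal_def]
    refine (h1.exp.const_mul (√(2 * Real.pi * ((1 : NNReal) : ℝ)))⁻¹).congr_deriv ?_
    ring
  have hpow : ∀ x : ℝ, HasDerivAt (fun v : ℝ => (u + Complex.I * v) ^ (m + 1))
      ((m + 1) * (u + Complex.I * x) ^ m * Complex.I) x := by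
    intro x
    have h1 : HasDerivAt (fun v : ℝ => u + Complex.I * v) Complex.I x := by
      simpa using ((hasDerivAt_id x).ofReal_comp.const_mul Complex.I).const_add u
    exact (h1.pow (m + 1)).congr_deriv (by push_cast; simp)
  have h0 := integrable_add_I_mul_pow u m
  have h1 := integrable_add_I_mul_pow u (m + 1)
  have h2 := integrable_add_I_mul_pow u (m + 2)
  -- `i v = (u + i v) - u` turns the factor `v` into a shift of the degree
  have hder : ∀ x : ℝ, HasDerivAt
      (fun v : ℝ => gaussianPDFReal 0 1 v • (u + Complex.I * v) ^ (m + 1))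
      (gaussianPDFReal 0 1 x • (Complex.I * ((m + 1) * (u + Complex.I * x) ^ m +
        ((u + Complex.I * x) ^ (m + 2) - u * (u + Complex.I * x) ^ (m + 1))))) x := by
    intro x
    refine ((hpdf x).smul (hpow x)).congr_deriv ?_
    simp only [Complex.real_smul]
    push_cast
    linear_combination (-x * gaussianPDFReal 0 1 x * (u + Complex.I * x) ^ (m + 1) : ℂ) *
      Complex.I_sq
  have h21 : Integrable (fun v : ℝ => (u + Complex.I * v) ^ (m + 2) -
      u * (u + Complex.I * v) ^ (m + 1)) gamma := h2.sub (h1.const_mul u)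
  have hint := ((h0.const_mul ((m : ℂ) + 1)).add h21).const_mul Complex.I
  have hz := integral_eq_zero_of_hasDerivAt_of_integrable hder ((hI _).1 hint) ((hI _).1 h1)
  rw [← integral_gaussianReal_eq_integral_smul one_ne_zero, integral_const_mul,
    integral_add (h0.const_mul _) h21,
    integral_sub h2 (h1.const_mul u), integral_const_mul, integral_const_mul] at hz
  have := (mul_eq_zero.1 hz).resolve_left Complex.I_ne_zero
  linear_combination this

/-- Averaging out the imaginary Gaussian produces the Hermite polynomials of variance `c`. -/
lemma integral_add_I_mul_mul_sqrt_pow (u c : ℝ) (hc : 0 ≤ c) (i : ℕ) :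
    ∫ v : ℝ, (((u : ℂ) + Complex.I * v) * (√c : ℂ)) ^ i ∂gamma =
      kraw c 0 ((√c * u : ℝ) : ℂ) i := by
  have hs : ((√c : ℝ) : ℂ) ^ 2 = c := by rw [← Complex.ofReal_pow, Real.sq_sqrt hc]
  simp only [mul_pow]
  rw [integral_mul_const]
  induction i using Nat.twoStepInduction with
  | zero => simp [kraw]
  | one =>
    have hid : ∫ v : ℝ, (v : ℂ) ∂gamma = 0 := by
      rw [integral_complex_ofReal, integral_id_gaussianReal, Complex.ofReal_zero]
    have hi : Integrable (fun v : ℝ => Complex.I * (v : ℂ)) gamma := by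
      simpa using integrable_add_I_mul_pow 0 1
    simp only [pow_one]
    rw [integral_add (integrable_const _) hi, integral_const_mul, hid]
    simp [kraw, mul_comm]
  | more i h1 h2 =>
    rw [kraw, ← h1, ← h2, integral_add_I_mul_pow_succ_succ]
    push_cast
    linear_combination (-(i + 1 : ℂ) * (√c : ℂ) ^ i *
      ∫ v : ℝ, ((u : ℂ) + Complex.I * v) ^ i ∂gamma) * hs

lemma integrable_add_I_mul_mul_pow (u r : ℂ) (i : ℕ) :
    Integrable (fun v : ℝ => ((u + Complex.I * v) * r) ^ i) gamma := by
  simp only [mul_pow]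
  exact (integrable_add_I_mul_pow u i).mul_const _

lemma gaussArg_eq (s : ℝ) (z : ℂ) (L : ℕ) (a : ℕ → ℂ) (u x v y : ℝ) :
    gaussArg s z L a u x v y = ∑ l ∈ Finset.range (L + 1), a l *
      ∑ ij ∈ Finset.HasAntidiagonal.antidiagonal l, (l.choose ij.1 : ℂ) *
        ((((u : ℂ) + Complex.I * v) * (√s : ℂ)) ^ ij.1 *
          (z ^ ij.2 * (((x : ℂ) + Complex.I * y) * (√(1 - s) : ℂ)) ^ ij.2)) := by
  rw [gaussArg, gpoly]
  refine Finset.sum_congr rfl fun l _ => ?_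
  rw [(Commute.all _ _).add_pow']
  refine congrArg _ (Finset.sum_congr rfl fun ij _ => ?_)
  rw [nsmul_eq_mul, mul_assoc z, mul_pow z]

lemma integrable_gaussArg (s : ℝ) (z : ℂ) (L : ℕ) (a : ℕ → ℂ) (u x : ℝ) :
    Integrable (fun vy : ℝ × ℝ => gaussArg s z L a u x vy.1 vy.2) (gamma.prod gamma) := by
  simp only [gaussArg_eq]
  refine integrable_finsetSum _ fun l _ => (integrable_finsetSum _ fun ij _ => ?_).const_mul _
  exact (Integrable.mul_prod (integrable_add_I_mul_mul_pow u _ ij.1)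
    ((integrable_add_I_mul_mul_pow x _ ij.2).const_mul _)).const_mul _

lemma gaussInner_eq_mixPoly {s : ℝ} (hs0 : 0 ≤ s) (hs1 : s ≤ 1) (z : ℂ) (L : ℕ) (a : ℕ → ℂ)
    (u x : ℝ) : gaussInner s z L a u x =
      mixPoly z L a s (1 - s) 0 (√s * u) (√(1 - s) * x) := by
  have hv : ∀ y : ℝ, ∫ v, gaussArg s z L a u x v y ∂gamma =
      ∑ l ∈ Finset.range (L + 1), a l *
        ∑ ij ∈ Finset.HasAntidiagonal.antidiagonal l, (l.choose ij.1 : ℂ) *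
          (kraw s 0 ((√s * u : ℝ) : ℂ) ij.1 *
            (z ^ ij.2 * (((x : ℂ) + Complex.I * y) * (√(1 - s) : ℂ)) ^ ij.2)) := by
    intro y
    have hi : ∀ l (ij : ℕ × ℕ), Integrable (fun v : ℝ => (Nat.choose l ij.1 : ℂ) *
        ((((u : ℂ) + Complex.I * v) * (√s : ℂ)) ^ ij.1 *
          (z ^ ij.2 * (((x : ℂ) + Complex.I * y) * (√(1 - s) : ℂ)) ^ ij.2))) gamma := fun l ij =>
      ((integrable_add_I_mul_mul_pow u _ ij.1).mul_const _).const_mul _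
    simp only [gaussArg_eq]
    rw [integral_finsetSum _ fun l _ => (integrable_finsetSum _ fun ij _ => hi l ij).const_mul _]
    refine Finset.sum_congr rfl fun l _ => ?_
    rw [integral_const_mul, integral_finsetSum _ fun ij _ => hi l ij]
    refine congrArg _ (Finset.sum_congr rfl fun ij _ => ?_)
    rw [integral_const_mul, integral_mul_const, integral_add_I_mul_mul_sqrt_pow u s hs0]
  have hi : ∀ l (ij : ℕ × ℕ), Integrable (fun y : ℝ => (Nat.choose l ij.1 : ℂ) *
      (kraw s 0 ((√s * u : ℝ) : ℂ) ij.1 *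
        (z ^ ij.2 * (((x : ℂ) + Complex.I * y) * (√(1 - s) : ℂ)) ^ ij.2))) gamma := fun l ij =>
    (((integrable_add_I_mul_mul_pow x _ ij.2).const_mul _).const_mul _).const_mul _
  rw [gaussInner]
  simp only [hv]
  rw [integral_finsetSum _ fun l _ => (integrable_finsetSum _ fun ij _ => hi l ij).const_mul _,
    mixPoly]
  refine Finset.sum_congr rfl fun l _ => ?_
  rw [integral_const_mul, integral_finsetSum _ fun ij _ => hi l ij]
  refine congrArg _ (Finset.sum_congr rfl fun ij _ => ?_)
  rw [integral_const_mul, integral_const_mul, integral_const_mul,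
    integral_add_I_mul_mul_sqrt_pow x (1 - s) (by linarith)]
  push_cast
  ring

lemma integrable_exp_two_mul_abs_gaussianReal (σ : NNReal) :
    Integrable (fun x : ℝ => Real.exp (2 * |x|)) (gaussianReal 0 σ) := by
  exact integrable_exp_mul_abs (X := fun x : ℝ => x) (t := 2)
    (integrable_exp_mul_gaussianReal (μ := 0) (v := σ) 2)
    (integrable_exp_mul_gaussianReal (μ := 0) (v := σ) (-2))

lemma gaussianReal_eq_map_sqrt_mul {c : ℝ} (hc : 0 ≤ c) :
    gaussianReal 0 ⟨c, hc⟩ = gamma.map fun x => √c * x := by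
  rw [gamma, gaussianReal_map_const_mul, mul_zero]
  congr 1
  ext
  simp [Real.sq_sqrt hc]
  rfl

/-! ### Convergence of the mixed norms -/

lemma cubeMixed_eq_integral (p q : ℝ) (z : ℂ) (L : ℕ) (a : ℕ → ℂ) (n k : ℕ) :
    cubeMixed p q z L a n k =
      ∫ α, (∫ β, ‖mixPoly z L a (Fintype.card {j : Fin n // (j : ℕ) < k} / n)
          (Fintype.card {j : Fin n // ¬ (j : ℕ) < k} / n) (1 / n) α β‖ ^ q
        ∂(signLaw {j : Fin n // ¬ (j : ℕ) < k} (1 / √n))) ^ (p / q)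
        ∂(signLaw {j : Fin n // (j : ℕ) < k} (1 / √n)) := by
  rw [integral_signLaw_eq_expect, cubeMixed]
  refine Finset.expect_congr rfl fun x' _ => ?_
  rw [integral_signLaw_eq_expect]
  simp only [sum_phi_cubePoint]

lemma tendsto_card_div {s : ℝ} (hs1 : s < 1) {k : ℕ → ℕ}
    (hk : Tendsto (fun n : ℕ => (k n : ℝ) / (n : ℝ)) atTop (𝓝 s)) :
    Tendsto (fun n : ℕ => (Fintype.card {j : Fin n // (j : ℕ) < k n} : ℝ) / n) atTop (𝓝 s) ∧
      Tendsto (fun n : ℕ => (Fintype.card {j : Fin n // ¬ (j : ℕ) < k n} : ℝ) / n) atTop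
        (𝓝 (1 - s)) := by
  have hle : ∀ᶠ n : ℕ in atTop, 0 < n ∧ k n ≤ n := by
    filter_upwards [hk.eventually (gt_mem_nhds hs1), eventually_gt_atTop 0] with n hn hn0
    refine ⟨hn0, ?_⟩
    rw [div_lt_one (by exact_mod_cast hn0)] at hn
    exact_mod_cast hn.le
  have hcard : ∀ n, k n ≤ n → Fintype.card {j : Fin n // (j : ℕ) < k n} = k n := by
    intro n hn
    rw [Fintype.card_subtype, Fin.card_filter_val_lt, min_eq_right hn]
  constructor
  · refine hk.congr' ?_
    filter_upwards [hle] with n hn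
    rw [hcard n hn.2]
  · refine (hk.const_sub 1).congr' ?_
    filter_upwards [hle] with n hn
    have hn0 : (n : ℝ) ≠ 0 := by exact_mod_cast hn.1.ne'
    rw [Fintype.card_subtype_compl, hcard n hn.2, Fintype.card_fin, Nat.cast_sub hn.2, sub_div,
      div_self hn0]

lemma card_subtype_div_le_one {n : ℕ} (P : Fin n → Prop) [DecidablePred P] :
    (Fintype.card {j : Fin n // P j} : ℝ) / n ≤ 1 := by
  have h := Fintype.card_subtype_le P
  rw [Fintype.card_fin] at h
  exact div_le_one_of_le₀ (by exact_mod_cast h) (Nat.cast_nonneg n)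

lemma integral_exp_two_abs_signLaw_subtype_le {n : ℕ} (P : Fin n → Prop) [DecidablePred P] :
    ∫ t, Real.exp (2 * |t|) ∂(signLaw {j : Fin n // P j} (1 / √n)) ≤ 2 * Real.exp 2 := by
  refine (integral_exp_two_abs_signLaw_le _ _).trans ?_
  have h := card_subtype_div_le_one P
  have h2 : (1 / √(n : ℝ)) ^ 2 = 1 / n := by
    rw [div_pow, Real.sq_sqrt (Nat.cast_nonneg n), one_pow]
  rw [h2]
  gcongr
  calc 2 * (1 / (n : ℝ)) * Fintype.card {j : Fin n // P j}
      = 2 * ((Fintype.card {j : Fin n // P j} : ℝ) / n) := by ring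
    _ ≤ 2 := by linarith

/-- Convergence of the mixed norms with the limit written in terms of the Gaussian laws of variances
`s` and `1 - s` of the two block sums. It applies `tendsto_integral_of_tendsto_prod_nhds` twice,
first in the sum `β` of the last block along all `α_n → α`, then in `α`. -/
lemma mixed_norm_limit (p q : ℝ) (hp : 1 ≤ p) (hpq : p ≤ q) (z : ℂ) (L : ℕ) (a : ℕ → ℂ)
    {s : ℝ} (hs0 : 0 ≤ s) (hs1 : s < 1) {k : ℕ → ℕ}
    (hk : Tendsto (fun n : ℕ => (k n : ℝ) / (n : ℝ)) atTop (𝓝 s)) :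
    (∀ α, Integrable (fun β => ‖mixPoly z L a s (1 - s) 0 α β‖ ^ q)
      (gaussianReal 0 ⟨1 - s, by linarith⟩)) ∧
    Continuous (fun α => (∫ β, ‖mixPoly z L a s (1 - s) 0 α β‖ ^ q
      ∂(gaussianReal 0 ⟨1 - s, by linarith⟩)) ^ (p / q)) ∧
    Integrable (fun α => (∫ β, ‖mixPoly z L a s (1 - s) 0 α β‖ ^ q
      ∂(gaussianReal 0 ⟨1 - s, by linarith⟩)) ^ (p / q)) (gaussianReal 0 ⟨s, hs0⟩) ∧
    Tendsto (fun n => cubeMixed p q z L a n (k n)) atTop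
      (𝓝 (∫ α, (∫ β, ‖mixPoly z L a s (1 - s) 0 α β‖ ^ q
        ∂(gaussianReal 0 ⟨1 - s, by linarith⟩)) ^ (p / q) ∂(gaussianReal 0 ⟨s, hs0⟩))) := by
  have hp0 : 0 < p := by linarith
  have hq : 0 < q := by linarith
  have hs1' : 0 ≤ 1 - s := by linarith
  obtain ⟨hc, hd⟩ := tendsto_card_div hs1 hk
  have hε : Tendsto (fun n : ℕ => 1 / (n : ℝ)) atTop (𝓝 0) := tendsto_one_div_atTop_nhds_zero_nat
  have hc1 := fun n => card_subtype_div_le_one fun j : Fin n => (j : ℕ) < k n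
  have hd1 := fun n => card_subtype_div_le_one fun j : Fin n => ¬ (j : ℕ) < k n
  set c : ℕ → ℝ := fun n => (Fintype.card {j : Fin n // (j : ℕ) < k n} : ℝ) / n
  set d : ℕ → ℝ := fun n => (Fintype.card {j : Fin n // ¬ (j : ℕ) < k n} : ℝ) / n
  -- growth rate `1 / q` of the polynomial becomes rate `1` for its `q`-th power
  obtain ⟨K, hK, HK⟩ := exists_norm_mixPoly_le z L a (δ := 1 / q) (by positivity)
  have hbound : ∀ n α β, ‖mixPoly z L a (c n) (d n) (1 / n) α β‖ ^ q ≤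
      K ^ q * Real.exp |α| * Real.exp |β| := by
    intro n α β
    have habs : ∀ t : ℝ, 0 ≤ t → t ≤ 1 → |t| ≤ 1 := fun t h0 h1 => by rwa [abs_of_nonneg h0]
    have h := HK (c n) (d n) (1 / n) α β (habs _ (by positivity) (hc1 n))
      (habs _ (by positivity) (hd1 n))
      (habs _ (by positivity) (by simpa using Nat.cast_inv_le_one n))
    refine (Real.rpow_le_rpow (norm_nonneg _) h hq.le).trans_eq ?_
    rw [Real.mul_rpow (by positivity) (by positivity), Real.mul_rpow (by positivity) (by positivity),
      ← Real.exp_mul, ← Real.exp_mul]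
    congr <;> field_simp
  have hinner := fun α : ℝ => tendsto_integral_of_tendsto_prod_nhds
    (l := (atTop : Filter ℕ) ×ˢ 𝓝 α)
    (μ := fun t : ℕ × ℝ => signProb {j : Fin t.1 // ¬ (j : ℕ) < k t.1} (1 / √t.1))
    (ν := gaussProb ⟨1 - s, hs1'⟩)
    ((tendsto_signProb (σ := ⟨1 - s, hs1'⟩) hd).comp tendsto_fst)
    (f := fun t β => ‖mixPoly z L a (c t.1) (d t.1) (1 / t.1) t.2 β‖ ^ q)
    (g := fun β => ‖mixPoly z L a s (1 - s) 0 α β‖ ^ q)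
    (fun β => by
      have h1 : Tendsto (fun t : (ℕ × ℝ) × ℝ => (c t.1.1, d t.1.1, 1 / (t.1.1 : ℝ), t.1.2, t.2))
          ((atTop ×ˢ 𝓝 α) ×ˢ 𝓝 β) (𝓝 (s, 1 - s, 0, α, β)) := by
        have hf : Tendsto (fun t : (ℕ × ℝ) × ℝ => t.1.1) ((atTop ×ˢ 𝓝 α) ×ˢ 𝓝 β) atTop :=
          tendsto_fst.comp tendsto_fst
        exact (hc.comp hf).prodMk_nhds ((hd.comp hf).prodMk_nhds ((hε.comp hf).prodMk_nhds
          ((tendsto_snd.comp tendsto_fst).prodMk_nhds tendsto_snd)))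
      exact (((continuous_mixPoly z L a).tendsto _).comp h1).norm.rpow_const (Or.inr hq.le))
    (fun t => (integrable_signLaw _ _ _).aestronglyMeasurable)
    (C := K ^ q * Real.exp (|α| + 1)) (M := 2 * Real.exp 2) (by positivity)
    (by
      have hα : ∀ᶠ t : ℕ × ℝ in atTop ×ˢ 𝓝 α, |t.2| < |α| + 1 :=
        tendsto_snd.eventually ((continuous_abs.tendsto α).eventually
          (gt_mem_nhds (lt_add_one _)))
      filter_upwards [hα] with t ht β
      rw [abs_of_nonneg (by positivity)]
      refine (hbound _ _ _).trans ?_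
      gcongr)
    (fun t => integrable_signLaw _ _ _)
    (Eventually.of_forall fun t => integral_exp_two_abs_signLaw_subtype_le _)
    (integrable_exp_two_mul_abs_gaussianReal _)
  have houter := tendsto_integral_of_tendsto_prod_nhds
    (l := (atTop : Filter ℕ))
    (μ := fun n => signProb {j : Fin n // (j : ℕ) < k n} (1 / √n))
    (ν := gaussProb ⟨s, hs0⟩)
    (tendsto_signProb (σ := ⟨s, hs0⟩) hc)
    (f := fun n α => (∫ β, ‖mixPoly z L a (c n) (d n) (1 / n) α β‖ ^ q
        ∂(signLaw {j : Fin n // ¬ (j : ℕ) < k n} (1 / √n))) ^ (p / q))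
    (g := fun α => (∫ β, ‖mixPoly z L a s (1 - s) 0 α β‖ ^ q
      ∂(gaussianReal 0 ⟨1 - s, hs1'⟩)) ^ (p / q))
    (fun α => (hinner α).2.2.rpow_const (Or.inr (by positivity)))
    (fun n => (integrable_signLaw _ _ _).aestronglyMeasurable)
    (C := (K ^ q * (2 * Real.exp 2)) ^ (p / q)) (M := 2 * Real.exp 2) (by positivity)
    (Eventually.of_forall fun n α => by
      have h0 : 0 ≤ ∫ β, ‖mixPoly z L a (c n) (d n) (1 / n) α β‖ ^ q
          ∂(signLaw {j : Fin n // ¬ (j : ℕ) < k n} (1 / √n)) :=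
        integral_nonneg fun β => by positivity
      have h1 : ∫ β, ‖mixPoly z L a (c n) (d n) (1 / n) α β‖ ^ q
          ∂(signLaw {j : Fin n // ¬ (j : ℕ) < k n} (1 / √n)) ≤
          K ^ q * (2 * Real.exp 2) * Real.exp |α| := by
        calc _ ≤ ∫ β, K ^ q * Real.exp |α| * Real.exp (2 * |β|)
              ∂(signLaw {j : Fin n // ¬ (j : ℕ) < k n} (1 / √n)) := by
              refine integral_mono (integrable_signLaw _ _ _) (integrable_signLaw _ _ _)
                fun β => (hbound n α β).trans ?_
              gcongr
              linarith [abs_nonneg β]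
          _ ≤ K ^ q * Real.exp |α| * (2 * Real.exp 2) := by
              rw [integral_const_mul]
              gcongr
              exact integral_exp_two_abs_signLaw_subtype_le _
          _ = _ := by ring
      rw [abs_of_nonneg (Real.rpow_nonneg h0 _)]
      refine (Real.rpow_le_rpow h0 h1 (by positivity)).trans ?_
      rw [Real.mul_rpow (by positivity) (by positivity), ← Real.exp_mul]
      have hpq1 : p / q ≤ 1 := (div_le_one hq).2 hpq
      gcongr
      exact mul_le_of_le_one_right (abs_nonneg α) hpq1)
    (fun n => integrable_signLaw _ _ _)
    (Eventually.of_forall fun n => integral_exp_two_abs_signLaw_subtype_le _)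
    (integrable_exp_two_mul_abs_gaussianReal _)
  refine ⟨fun α => (hinner α).2.1, houter.1, houter.2.1, ?_⟩
  simp only [cubeMixed_eq_integral]
  exact houter.2.2

end CubeGauss

end

theorem theorem2p3 (p q : ℝ) (hp : 1 ≤ p) (hpq : p ≤ q) (z : ℂ) (L : ℕ) (a : ℕ → ℂ)
    (s : ℝ) (hs0 : 0 < s) (hs1 : s < 1) (k : ℕ → ℕ)
    (hk : Filter.Tendsto (fun n : ℕ => (k n : ℝ) / (n : ℝ)) Filter.atTop (nhds s)) :
    (∀ u x : ℝ, MeasureTheory.Integrable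
      (fun vy : ℝ × ℝ => CubeGauss.gaussArg s z L a u x vy.1 vy.2)
      (CubeGauss.gamma.prod CubeGauss.gamma)) ∧
    (∀ u : ℝ, MeasureTheory.Integrable
      (fun x : ℝ => ‖CubeGauss.gaussInner s z L a u x‖ ^ q) CubeGauss.gamma) ∧
    MeasureTheory.Integrable
      (fun u : ℝ => (∫ x, ‖CubeGauss.gaussInner s z L a u x‖ ^ q ∂CubeGauss.gamma) ^ (p / q))
      CubeGauss.gamma ∧
    Filter.Tendsto (fun n : ℕ => CubeGauss.cubeMixed p q z L a n (k n)) Filter.atTop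
      (nhds (∫ u, (∫ x, ‖CubeGauss.gaussInner s z L a u x‖ ^ q ∂CubeGauss.gamma) ^ (p / q)
        ∂CubeGauss.gamma)) := by
  have hs1' : 0 ≤ 1 - s := by linarith
  have hq : 0 ≤ q := by linarith
  obtain ⟨h1, h2, h3, h4⟩ := CubeGauss.mixed_norm_limit p q hp hpq z L a hs0.le hs1 hk
  rw [CubeGauss.gaussianReal_eq_map_sqrt_mul hs0.le] at h3 h4
  rw [CubeGauss.gaussianReal_eq_map_sqrt_mul hs1'] at h1 h2 h3 h4
  have hm : ∀ r : ℝ, AEMeasurable (fun x : ℝ => r * x) CubeGauss.gamma := fun r => by fun_prop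
  have hcont : ∀ α, Continuous fun β => ‖CubeGauss.mixPoly z L a s (1 - s) 0 α β‖ ^ q := by
    intro α
    refine Continuous.rpow_const ?_ fun _ => Or.inr hq
    exact ((CubeGauss.continuous_mixPoly z L a).comp
      (f := fun β : ℝ => (s, 1 - s, (0 : ℝ), α, β)) (by fun_prop)).norm
  have hint : ∀ α, ∫ β, ‖CubeGauss.mixPoly z L a s (1 - s) 0 α β‖ ^ q
      ∂(CubeGauss.gamma.map fun x => √(1 - s) * x) =
      ∫ x, ‖CubeGauss.mixPoly z L a s (1 - s) 0 α (√(1 - s) * x)‖ ^ q ∂CubeGauss.gamma :=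
    fun α => MeasureTheory.integral_map (hm _) (hcont α).aestronglyMeasurable
  simp only [hint] at h2 h3 h4
  simp only [CubeGauss.gaussInner_eq_mixPoly hs0.le hs1.le]
  refine ⟨CubeGauss.integrable_gaussArg s z L a, fun u => ?_, ?_, ?_⟩
  · exact (MeasureTheory.integrable_map_measure (hcont _).aestronglyMeasurable (hm _)).1 (h1 _)
  · exact (MeasureTheory.integrable_map_measure h2.aestronglyMeasurable (hm _)).1 h3
  · rwa [MeasureTheory.integral_map (hm _) h2.aestronglyMeasurable] at h4
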